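/- Let $n\ge 0$ be an integer and let $A,B\in\mathbb{R}^{n\times n}$ be symmetric matrices. For a symmetric matrix $M\in\mathbb{R}^{n\times n}$ put $Q(M)=\{v\in\mathbb{R}^n : v^TMv=0\}$ and $N(M)=\{v\in\mathbb{R}^n : Mv=0\}$, and let $$I_{\succeq}(A,B)=\{\sigma\in\mathbb{R} : A+\sigma B\succeq 0\},\qquad I_{\succeq}(B,A)=\{\sigma\in\mathbb{R} : B+\sigma A\succeq 0\},$$ where $M\succeq 0$ means that $M$ is positive semidefinite. Suppose that at least one of the following conditions holds: (S1) $I_{\succeq}(A,B)$ contains more than one point; (S2) $I_{\succeq}(B,A)$ contains more than one point; (S3) $Q(A)\cap Q(B)=N(A)\cap N(B)$ and $\dim\bigl(N(A)\cap N(B)\bigr)\neq n-2$. Then $A$ and $B$ are simultaneously diagonalizable via congruence (SDC); that is, there exists a nonsingular matrix $C\in\mathbb{R}^{n\times n}$ such that both $C^TAC$ and $C^TBC$ are diagonal. -/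

import Mathlib

namespace MatrixPencil

/-- `I_⪰(A, B) = {σ ∈ ℝ | A + σ B ⪰ 0}`. -/
def psdInterval {n : ℕ} (A B : Matrix (Fin n) (Fin n) ℝ) : Set ℝ :=
  {σ | (A + σ • B).PosSemidef}

/-- `Q(A) = {v | vᵀ A v = 0}`. -/
def quadZeros {n : ℕ} (A : Matrix (Fin n) (Fin n) ℝ) : Set (Fin n → ℝ) :=
  {v | v ⬝ᵥ A.mulVec v = 0}

/-- `N(A) = {v | A v = 0}`, as a linear subspace of `ℝⁿ`. -/
def nullSpace {n : ℕ} (A : Matrix (Fin n) (Fin n) ℝ) : Submodule ℝ (Fin n → ℝ) :=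
  LinearMap.ker A.mulVecLin

/-- `A` and `B` are simultaneously diagonalizable via congruence: there is a nonsingular real
matrix `C` such that `Cᵀ A C` and `Cᵀ B C` are both diagonal. -/
def SimDiagCongruence {n : ℕ} (A B : Matrix (Fin n) (Fin n) ℝ) : Prop :=
  ∃ C : Matrix (Fin n) (Fin n) ℝ,
    IsUnit C ∧ (C.transpose * A * C).IsDiag ∧ (C.transpose * B * C).IsDiag

end MatrixPencil

/-! Everything reduces to a positive semidefinite M in the pencil and a second form that vanishes on
ker M (`SimDiagCongruence.of_posSemidef`): a congruence turns M into a 0/1 diagonal matrix, after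
which the spectral theorem diagonalizes both.

If an interval has two points, M is the sum of the two semidefinite matrices. Under (S3), let N =
N(A) ∩ N(B). Off N, B has no zero on Q(A). If B took both signs there, the codimension of N would be
exactly two: otherwise a conic path in Q(A) joins the two signs and passes through a common zero
outside N (`false_of_sign_change`). So, up to replacing B by -B, B is positive on Q(A) off N.
Compactness makes this quantitative, and an S-lemma argument (`exists_add_mul_nonneg`) gives a
semidefinite kB + tA with kernel inside N(A). -/

/-! ### Sign changes on the zero set of a form -/

/-- A form which takes both signs on a totally isotropic plane of `P` has a common zero with `P`. -/
theorem false_of_isotropic_plane {V : Type*} [AddCommGroup V] [Module ℝ V]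
    {P R : LinearMap.BilinForm ℝ V} (hP : ∀ x y, P x y = P y x) (hR : ∀ x y, R x y = R y x)
    {N : Submodule ℝ V} (hN0 : ∀ v ∈ N, ∀ w, R v w = 0)
    (hN : ∀ v, P v v = 0 → R v v = 0 → v ∈ N) {x y : V}
    (hx : P x x = 0) (hy : P y y = 0) (hxy : P x y = 0)
    (hRx : 0 < R x x) (hRy : R y y < 0) : False := by
  have hd : 0 ≤ R x y ^ 2 - R x x * R y y := by nlinarith [sq_nonneg (R x y)]
  obtain ⟨s, hs⟩ : ∃ s : ℝ, R x x * s ^ 2 + 2 * R x y * s + R y y = 0 := by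
    refine ⟨(-R x y + √(R x y ^ 2 - R x x * R y y)) / R x x, ?_⟩
    have h2 := Real.sq_sqrt hd
    field_simp
    linear_combination h2
  have hv : s • x + y ∈ N := by
    refine hN _ ?_ ?_
    · simp [hx, hy, hxy, hP y x]
    · simp [hR y x]
      linear_combination hs
  have h1 := hN0 _ hv x
  have h2 := hN0 _ hv y
  simp only [map_add, map_smul, LinearMap.add_apply, LinearMap.smul_apply, smul_eq_mul] at h1 h2
  rw [hR y x] at h1
  nlinarith [mul_nonneg (sq_nonneg s) hRx.le]

/-- If the only common zeros of `P` and `R` lie in their common radical `N`, then `R` cannot take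
both signs on the zero set of `P`, provided that `N` has codimension larger than two. -/
theorem false_of_sign_change {V : Type*} [AddCommGroup V] [Module ℝ V]
    {P R : LinearMap.BilinForm ℝ V} (hP : ∀ x y, P x y = P y x) (hR : ∀ x y, R x y = R y x)
    {N : Submodule ℝ V} (hN0 : ∀ v ∈ N, ∀ w, R v w = 0)
    (hN : ∀ v, P v v = 0 → R v v = 0 → v ∈ N) {x y z : V}
    (hx : P x x = 0) (hy : P y y = 0) (hRx : 0 < R x x) (hRy : R y y < 0)
    (hz : ∀ a b : ℝ, z + a • x + b • y ∉ N) : False := by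
  by_cases hxy : P x y = 0
  · exact false_of_isotropic_plane hP hR hN0 hN hx hy hxy hRx hRy
  obtain ⟨w, hw, hwx, hwy⟩ : ∃ w : V, (∀ a b : ℝ, w + a • x + b • y ∉ N) ∧
      P w x = 0 ∧ P w y = 0 := by
    -- Project z to the `P`-orthogonal complement of the hyperbolic plane spanned by x and y.
    refine ⟨z + (-(P z y / P x y)) • x + (-(P z x / P x y)) • y, fun a b h ↦ ?_, ?_, ?_⟩
    · refine hz (-(P z y / P x y) + a) (-(P z x / P x y) + b) ?_
      convert h using 1
      module
    · simp [hx, hP y x, hxy]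
    · simp [hy, hxy]
  have hxw : P x w = 0 := by rw [hP, hwx]
  have hyw : P y w = 0 := by rw [hP, hwy]
  have hyx : P y x = P x y := hP y x
  by_cases hc : P w w = 0
  · have hRw : R w w ≠ 0 := fun h ↦ hw 0 0 (by simpa using hN w hc h)
    rcases hRw.lt_or_gt with h | h
    · exact false_of_isotropic_plane hP hR hN0 hN hx hc hxw hRx h
    · exact false_of_isotropic_plane hP hR hN0 hN hc hy hwy h hRy
  -- This t puts the whole conic `v` below, running from x to t • y, on the zero set of `P`.
  set t : ℝ := -(P w w) / (2 * P x y) with ht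
  have ht0 : t ≠ 0 := div_ne_zero (neg_ne_zero.2 hc) (mul_ne_zero two_ne_zero hxy)
  have htc : 2 * t * P x y + P w w = 0 := by rw [ht]; field_simp; ring
  let v : ℝ → V := fun s ↦ ((1 - s) ^ 2) • x + ((1 - s) * s) • w + (t * s ^ 2) • y
  have hPv (s : ℝ) : P (v s) (v s) = 0 := by
    simp only [v, map_add, map_smul, LinearMap.add_apply, LinearMap.smul_apply, smul_eq_mul, hx,
      hy, hwx, hwy, hxw, hyw, hyx]
    linear_combination (1 - s) ^ 2 * s ^ 2 * htc
  have hcont : Continuous fun s ↦ R (v s) (v s) := by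
    simp only [v, map_add, map_smul, LinearMap.add_apply, LinearMap.smul_apply, smul_eq_mul]
    fun_prop
  have h0 : R (v 0) (v 0) = R x x := by simp [v]
  have h1 : R (v 1) (v 1) = t ^ 2 * R y y := by simp [v]; ring
  have h1' : R (v 1) (v 1) < 0 := h1 ▸ mul_neg_of_pos_of_neg (by positivity) hRy
  obtain ⟨s, -, hs⟩ := intermediate_value_Icc' zero_le_one hcont.continuousOn
    (show (0 : ℝ) ∈ Set.Icc (R (v 1) (v 1)) (R (v 0) (v 0)) from ⟨h1'.le, h0 ▸ hRx.le⟩)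
  have hs : R (v s) (v s) = 0 := hs
  have hvN := hN _ (hPv s) hs
  by_cases hs0 : s = 0
  · rw [hs0, h0] at hs; exact hRx.ne' hs
  by_cases hs1 : 1 - s = 0
  · rw [show s = 1 by linarith] at hs; exact h1'.ne hs
  -- Dividing by the coefficient of w contradicts `hw`.
  have hm := N.smul_mem ((1 - s) * s)⁻¹ hvN
  refine hw ((1 - s) / s) (t * s / (1 - s)) ?_
  convert hm using 1
  simp only [v, smul_add, smul_smul]
  rw [inv_mul_cancel₀ (mul_ne_zero hs1 hs0), one_smul, add_comm w]
  congr 2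
  · congr 1; field_simp
  · field_simp

/-! ### The S-lemma and a compactness bound -/

/-- If `Q` is nonnegative on the zeros of `P`, then the ratios of `Q` and `P` on the positive
and the negative vectors of `P` are separated. -/
theorem mul_add_mul_nonneg_of_nonneg_on_zeros {V : Type*} [AddCommGroup V] [Module ℝ V]
    {P Q : LinearMap.BilinForm ℝ V} (hP : ∀ x y, P x y = P y x) (hQ : ∀ x y, Q x y = Q y x)
    (h : ∀ v, P v v = 0 → 0 ≤ Q v v) {x y : V} (hx : 0 < P x x) (hy : P y y < 0) :
    0 ≤ Q x x * (-P y y) + Q y y * P x x := by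
  have hd : 0 < P x y ^ 2 - P x x * P y y := by nlinarith [sq_nonneg (P x y)]
  set d := √(P x y ^ 2 - P x x * P y y) with hd'
  have hd0 : 0 < d := Real.sqrt_pos.2 hd
  have hsq : d ^ 2 = P x y ^ 2 - P x x * P y y := Real.sq_sqrt hd.le
  -- The two roots e = ±d give the two `P`-isotropic lines in the plane of x and y.
  have key (e : ℝ) (he : e ^ 2 = P x y ^ 2 - P x x * P y y) :
      0 ≤ Q x x * (e - P x y) ^ 2 + 2 * Q x y * (e - P x y) * P x x + Q y y * P x x ^ 2 := by
    have := h ((e - P x y) • x + P x x • y) (by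
      simp only [map_add, map_smul, LinearMap.add_apply, LinearMap.smul_apply, smul_eq_mul, hP y x]
      linear_combination P x x * he)
    simp only [map_add, map_smul, LinearMap.add_apply, LinearMap.smul_apply, smul_eq_mul,
      hQ y x] at this
    linarith
  have k1 := key d hsq
  have k2 := key (-d) (by rw [neg_sq, hsq])
  have hlt : |P x y| < d := by
    rw [← Real.sqrt_sq_eq_abs]
    exact Real.sqrt_lt_sqrt (sq_nonneg _) (by nlinarith)
  have h3 : 0 < d - P x y := by linarith [le_abs_self (P x y)]
  have h4 : 0 < d + P x y := by linarith [neg_abs_le (P x y)]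
  -- These positive weights cancel the cross term in `Q x y`.
  have h5 := add_nonneg (mul_nonneg h4.le k1) (mul_nonneg h3.le k2)
  have h6 : 0 ≤ (2 * d * P x x) * (Q x x * (-P y y) + Q y y * P x x) := by
    refine h5.trans_eq ?_
    linear_combination (2 * d * Q x x) * hsq
  exact nonneg_of_mul_nonneg_right h6 (by positivity)

/-- A form `Q` which is nonnegative on the zeros of `P` and bounded below by a multiple of `-|P|`
becomes nonnegative after adding a multiple of `P`. -/
theorem exists_add_mul_nonneg {V : Type*} [AddCommGroup V] [Module ℝ V]
    {P Q : LinearMap.BilinForm ℝ V} (hP : ∀ x y, P x y = P y x) (hQ : ∀ x y, Q x y = Q y x)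
    {c : ℝ} (h : ∀ v, 0 ≤ Q v v + c * |P v v|) :
    ∃ t : ℝ, ∀ v, 0 ≤ Q v v + t * P v v := by
  have h0 : ∀ v, P v v = 0 → 0 ≤ Q v v := fun v hv ↦ by simpa [hv] using h v
  -- Lower bounds that positive vectors impose on t; `-c` keeps the set nonempty when there are
  -- none.
  let S : Set ℝ := insert (-c) {r | ∃ x, 0 < P x x ∧ r = -Q x x / P x x}
  have hb : ∀ y, P y y < 0 → ∀ r ∈ S, r ≤ Q y y / (-P y y) := by
    rintro y hy r (rfl | ⟨x, hx, rfl⟩)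
    · rw [le_div_iff₀ (by linarith)]
      have := h y
      rw [abs_of_neg hy] at this
      linarith
    · rw [div_le_div_iff₀ hx (by linarith)]
      have := mul_add_mul_nonneg_of_nonneg_on_zeros hP hQ h0 hx hy
      linarith
  have hne : S.Nonempty := Set.insert_nonempty _ _
  have hbdd : BddAbove S := by
    refine ⟨max (-c) c, ?_⟩
    rintro r (rfl | ⟨x, hx, rfl⟩)
    · exact le_max_left _ _
    · refine le_max_of_le_right ?_
      rw [div_le_iff₀ hx]
      have := h x
      rw [abs_of_pos hx] at this
      linarith
  refine ⟨sSup S, fun v ↦ ?_⟩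
  rcases lt_trichotomy (P v v) 0 with hv | hv | hv
  · have := csSup_le hne (hb v hv)
    rw [le_div_iff₀ (by linarith)] at this
    linarith
  · simpa [hv] using h0 v hv
  · have := le_csSup hbdd (Set.mem_insert_of_mem (-c) ⟨v, hv, rfl⟩ : -Q v v / P v v ∈ S)
    rw [div_le_iff₀ hv] at this
    linarith

/-- The open sets f + k g > 0 increase with k and cover K, so one of them suffices. -/
theorem IsCompact.exists_add_mul_pos {X : Type*} [TopologicalSpace X] {K : Set X}
    (hK : IsCompact K) {f g : X → ℝ} (hf : Continuous f) (hg : Continuous g)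
    (hg0 : ∀ x ∈ K, 0 ≤ g x) (hfg : ∀ x ∈ K, g x = 0 → 0 < f x) :
    ∃ c : ℝ, 0 < c ∧ ∀ x ∈ K, 0 < f x + c * g x := by
  obtain ⟨t, ht⟩ := hK.elim_finite_subcover (fun k : ℕ ↦ {x | 0 < f x + k * g x})
    (fun k ↦ isOpen_lt continuous_const (by fun_prop)) (fun x hx ↦ by
      rw [Set.mem_iUnion]
      rcases (hg0 x hx).eq_or_lt with h | h
      · exact ⟨0, by simpa using hfg x hx h.symm⟩
      · obtain ⟨k, hk⟩ := exists_nat_gt (-f x / g x)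
        rw [div_lt_iff₀ h] at hk
        exact ⟨k, by simp only [Set.mem_ofPred_eq]; linarith⟩)
  refine ⟨(t.sup id : ℕ) + 1, by positivity, fun x hx ↦ ?_⟩
  obtain ⟨k, hk, hxk⟩ := by simpa using ht hx
  have hle : (k : ℝ) ≤ (t.sup id : ℕ) + 1 := by
    have : k ≤ t.sup id := Finset.le_sup (f := id) hk
    exact_mod_cast this.trans (Nat.le_succ _)
  nlinarith [mul_le_mul_of_nonneg_right hle (hg0 x hx)]

/-! ### Orthogonal diagonalization -/

open Matrix in
theorem Matrix.IsSymm.exists_orthogonal_diagonal {n : Type*} [Fintype n] [DecidableEq n]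
    {X : Matrix n n ℝ} (hX : X.IsSymm) :
    ∃ (V : Matrix n n ℝ) (d : n → ℝ), IsUnit V ∧ Vᵀ * V = 1 ∧ Vᵀ * X * V = diagonal d := by
  have hH : X.IsHermitian := by rw [IsHermitian, conjTranspose_eq_transpose_of_trivial, hX]
  have hs : star (hH.eigenvectorUnitary : Matrix n n ℝ) = (hH.eigenvectorUnitary : Matrix n n ℝ)ᵀ :=
    conjTranspose_eq_transpose_of_trivial _
  have h1 := Unitary.coe_star_mul_self hH.eigenvectorUnitary
  rw [hs] at h1
  refine ⟨hH.eigenvectorUnitary, hH.eigenvalues, IsUnit.of_mul_eq_one_right _ h1, h1, ?_⟩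
  have h2 := hH.spectral_theorem
  rw [Unitary.conjStarAlgAut_apply, hs] at h2
  generalize (hH.eigenvectorUnitary : Matrix n n ℝ) = V at h1 h2
  change _ = diagonal (RCLike.ofReal ∘ hH.eigenvalues : n → ℝ)
  generalize (RCLike.ofReal ∘ hH.eigenvalues : n → ℝ) = d at h2 ⊢
  rw [h2]
  simp only [← Matrix.mul_assoc]
  rw [h1, Matrix.one_mul, Matrix.mul_assoc, h1, Matrix.mul_one]

open Matrix in
/-- A symmetric idempotent `E` and a symmetric matrix `P` with `P E = P` are simultaneously
diagonalizable by an orthogonal matrix. -/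
theorem Matrix.exists_isDiag_of_idempotent {n : Type*} [Fintype n] [DecidableEq n]
    {E P : Matrix n n ℝ} (hE : E.IsSymm) (hP : P.IsSymm) (hEE : E * E = E) (hPE : P * E = P) :
    ∃ V : Matrix n n ℝ, IsUnit V ∧ (Vᵀ * E * V).IsDiag ∧ (Vᵀ * P * V).IsDiag := by
  -- With c + P invertible, P + cE = (c + P)E has the same kernel as E, so diagonalizing it also
  -- diagonalizes E.
  obtain ⟨c, hc⟩ := (Matrix.finite_spectrum (-P)).exists_notMem
  rw [spectrum.notMem_iff, sub_neg_eq_add] at hc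
  set Y := algebraMap ℝ (Matrix n n ℝ) c + P with hY
  have hX : Y * E = P + c • E := by
    rw [hY, add_mul, hPE, Algebra.algebraMap_eq_smul_one, smul_mul_assoc, one_mul, add_comm]
  have hEP : E * P = P := by
    have := congrArg transpose hPE
    rwa [transpose_mul, hE, hP] at this
  have hXs : (P + c • E).IsSymm := hP.add (hE.smul c)
  obtain ⟨V, d, hV, hVV, hd⟩ := hXs.exists_orthogonal_diagonal
  have hVV' : V * Vᵀ = 1 := mul_eq_one_comm.1 hVV
  have hF : Vᵀ * E * V = (Vᵀ * Y⁻¹ * V) * diagonal d := by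
    rw [← hd, ← hX]
    calc Vᵀ * E * V = Vᵀ * (Y⁻¹ * Y) * E * V := by
          rw [nonsing_inv_mul _ ((isUnit_iff_isUnit_det _).1 hc), Matrix.mul_one]
      _ = Vᵀ * Y⁻¹ * 1 * (Y * E) * V := by simp only [Matrix.mul_assoc, Matrix.mul_one]
      _ = _ := by rw [← hVV']; simp only [Matrix.mul_assoc]
  have hF2 : (Vᵀ * E * V) * diagonal d = diagonal d := by
    have h : E * (P + c • E) = P + c • E := by rw [mul_add, hEP, mul_smul_comm, hEE]
    rw [← hd]
    calc _ = Vᵀ * E * (V * Vᵀ) * (P + c • E) * V := by simp only [Matrix.mul_assoc]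
      _ = Vᵀ * (E * (P + c • E)) * V := by rw [hVV']; simp only [Matrix.mul_assoc, Matrix.one_mul]
      _ = _ := by rw [h]
  have hdiag : (Vᵀ * E * V).IsDiag := by
    intro i j hij
    by_cases hdj : d j = 0
    · rw [hF, mul_diagonal, hdj, mul_zero]
    · have := congrFun (congrFun hF2 i) j
      rw [mul_diagonal, diagonal_apply_ne _ hij] at this
      exact (mul_eq_zero.1 this).resolve_right hdj
  refine ⟨V, hV, hdiag, ?_⟩
  have : Vᵀ * P * V = diagonal d - c • (Vᵀ * E * V) := by
    rw [← hd, mul_add, add_mul, mul_smul_comm, smul_mul_assoc, add_sub_cancel_right]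
  rw [this]
  exact (isDiag_diagonal d).sub (hdiag.smul c)

/-! ### Criteria for simultaneous diagonalization -/

namespace MatrixPencil

open Matrix

variable {n : ℕ}

theorem SimDiagCongruence.of_congr {A B C : Matrix (Fin n) (Fin n) ℝ} (hC : IsUnit C)
    (h : SimDiagCongruence (Cᵀ * A * C) (Cᵀ * B * C)) : SimDiagCongruence A B := by
  obtain ⟨D, hD, h1, h2⟩ := h
  refine ⟨C * D, hC.mul hD, ?_, ?_⟩
  · simpa only [transpose_mul, Matrix.mul_assoc] using h1
  · simpa only [transpose_mul, Matrix.mul_assoc] using h2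

theorem SimDiagCongruence.combine {A B : Matrix (Fin n) (Fin n) ℝ} (h : SimDiagCongruence A B)
    (a b c d : ℝ) : SimDiagCongruence (a • A + b • B) (c • A + d • B) := by
  obtain ⟨C, hC, h1, h2⟩ := h
  have key (r s : ℝ) : (Cᵀ * (r • A + s • B) * C).IsDiag := by
    rw [mul_add, add_mul, mul_smul_comm, smul_mul_assoc, mul_smul_comm, smul_mul_assoc]
    exact (h1.smul r).add (h2.smul s)
  exact ⟨C, hC, key a b, key c d⟩

/-- A positive semidefinite matrix and a symmetric matrix whose kernel contains the kernel of the
first are simultaneously diagonalizable via congruence. -/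
theorem SimDiagCongruence.of_posSemidef {M P : Matrix (Fin n) (Fin n) ℝ} (hM : M.PosSemidef)
    (hP : P.IsSymm) (hker : ∀ v, M *ᵥ v = 0 → P *ᵥ v = 0) : SimDiagCongruence M P := by
  have hMs : M.IsSymm := by
    have := hM.1
    rwa [IsHermitian, conjTranspose_eq_transpose_of_trivial] at this
  obtain ⟨V, d, hV, hVV, hd⟩ := hMs.exists_orthogonal_diagonal
  have hd0 (i : Fin n) : 0 ≤ d i := by
    have h := hM.conjTranspose_mul_mul_same V
    rw [conjTranspose_eq_transpose_of_trivial, hd] at h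
    exact posSemidef_diagonal_iff.1 h i
  -- The value 1 on the kernel keeps the scaling invertible.
  let s : Fin n → ℝ := fun i ↦ if d i = 0 then 1 else (√(d i))⁻¹
  let e : Fin n → ℝ := fun i ↦ if d i = 0 then 0 else 1
  have hs : IsUnit (diagonal s) := by
    rw [isUnit_iff_isUnit_det, det_diagonal, isUnit_iff_ne_zero, Finset.prod_ne_zero_iff]
    intro i _
    by_cases h : d i = 0
    · simp [s, h]
    · simpa [s, h] using (Real.sqrt_ne_zero (hd0 i)).2 h
  have hC : IsUnit (V * diagonal s) := hV.mul hs
  have hE : (V * diagonal s)ᵀ * M * (V * diagonal s) = diagonal e := by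
    calc _ = diagonal s * (Vᵀ * M * V) * diagonal s := by
          simp only [transpose_mul, diagonal_transpose, Matrix.mul_assoc]
      _ = diagonal e := by
        rw [hd, diagonal_mul_diagonal, diagonal_mul_diagonal]
        congr 1
        funext i
        by_cases h : d i = 0
        · simp [s, e, h]
        · have h2 := Real.mul_self_sqrt (hd0 i)
          have h3 := (Real.sqrt_ne_zero (hd0 i)).2 h
          simp only [s, e, h, if_false]
          field_simp
          rw [sq, h2]
  refine .of_congr hC ?_
  rw [hE]
  set C := V * diagonal s
  have hee : diagonal e * diagonal e = diagonal e := by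
    rw [diagonal_mul_diagonal]
    congr 1
    funext i
    by_cases h : d i = 0 <;> simp [e, h]
  have hCt : IsUnit Cᵀ := (isUnit_transpose C).2 hC
  refine exists_isDiag_of_idempotent (isSymm_diagonal e) ?_ hee ?_
  · rw [IsSymm]
    simp only [transpose_mul, transpose_transpose, Matrix.mul_assoc, hP.eq]
  · rw [← sub_eq_zero, ← mul_sub_one]
    -- The columns of C(E - 1), with E = `diagonal e`, lie in ker M, hence in ker P.
    have h0 : M * (C * (diagonal e - 1)) = 0 := by
      have : Cᵀ * (M * (C * (diagonal e - 1))) = 0 := by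
        rw [← Matrix.mul_assoc, ← Matrix.mul_assoc, hE, mul_sub_one, hee, sub_self]
      exact hCt.mul_right_eq_zero.1 this
    have h1 : P * (C * (diagonal e - 1)) = 0 := by
      ext i j
      have := hker (fun k ↦ (C * (diagonal e - 1)) k j) (by
        ext k; exact congrFun (congrFun h0 k) j)
      exact congrFun this i
    rw [Matrix.mul_assoc, Matrix.mul_assoc, h1, Matrix.mul_zero]

/-- The kernel of a sum of semidefinite matrices is the intersection of their kernels; since σ ≠ τ,
B vanishes there. -/
theorem SimDiagCongruence.of_nontrivial_psdInterval {A B : Matrix (Fin n) (Fin n) ℝ}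
    (hB : B.IsSymm) (h : (psdInterval A B).Nontrivial) : SimDiagCongruence A B := by
  obtain ⟨σ, hσ, τ, hτ, hne⟩ := h
  have hσ : (A + σ • B).PosSemidef := hσ
  have hτ : (A + τ • B).PosSemidef := hτ
  have hker (v : Fin n → ℝ) (hv : ((A + σ • B) + (A + τ • B)) *ᵥ v = 0) : B *ᵥ v = 0 := by
    have h1 := hσ.dotProduct_mulVec_nonneg v
    have h2 := hτ.dotProduct_mulVec_nonneg v
    have h3 : star v ⬝ᵥ (A + σ • B) *ᵥ v + star v ⬝ᵥ (A + τ • B) *ᵥ v = 0 := by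
      rw [← dotProduct_add, ← add_mulVec, hv, dotProduct_zero]
    have h4 := (hσ.dotProduct_mulVec_zero_iff v).1 (by linarith)
    have h5 := (hτ.dotProduct_mulVec_zero_iff v).1 (by linarith)
    have h6 : (σ - τ) • (B *ᵥ v) = 0 := by
      rw [add_mulVec, smul_mulVec] at h4 h5
      rw [sub_smul, ← add_sub_add_left_eq_sub _ _ (A *ᵥ v), h4, h5, sub_zero]
    exact (smul_eq_zero.1 h6).resolve_left (sub_ne_zero.2 hne)
  have := (of_posSemidef (hσ.add hτ) hB hker).combine (1 / 2) (-(σ + τ) / 2) 0 1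
  convert this using 1 <;> module

theorem SimDiagCongruence.symm {A B : Matrix (Fin n) (Fin n) ℝ} (h : SimDiagCongruence A B) :
    SimDiagCongruence B A :=
  let ⟨C, hC, h1, h2⟩ := h
  ⟨C, hC, h2, h1⟩

/-- If `B` is positive on the zeros of `A` outside of the common kernel, then `A` and `B` are
simultaneously diagonalizable via congruence. -/
theorem SimDiagCongruence.of_pos_on_zeros {A B : Matrix (Fin n) (Fin n) ℝ} (hA : A.IsSymm)
    (hB : B.IsSymm)
    (h : ∀ v, v ⬝ᵥ A *ᵥ v = 0 → v ∉ nullSpace A ⊓ nullSpace B → 0 < v ⬝ᵥ B *ᵥ v) :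
    SimDiagCongruence A B := by
  obtain ⟨W, hW⟩ := (nullSpace A ⊓ nullSpace B).exists_isCompl
  have hK : IsCompact (Metric.sphere (0 : Fin n → ℝ) 1 ∩ W) :=
    (isCompact_sphere 0 1).inter_right W.closed_of_finiteDimensional
  have hKN : ∀ v ∈ Metric.sphere (0 : Fin n → ℝ) 1 ∩ W, v ∉ nullSpace A ⊓ nullSpace B := by
    rintro v ⟨hv1, hv2⟩ hv
    have : v = 0 := (Submodule.disjoint_def.1 hW.disjoint) v hv hv2
    simp [this] at hv1
  have hcont (X : Matrix (Fin n) (Fin n) ℝ) : Continuous fun v : Fin n → ℝ ↦ v ⬝ᵥ X *ᵥ v := by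
    fun_prop
  obtain ⟨c, -, hc⟩ := hK.exists_add_mul_pos (hcont B) (hcont A).abs (fun _ _ ↦ abs_nonneg _)
    (fun v hv hv0 ↦ h v (abs_eq_zero.1 hv0) (hKN v hv))
  obtain ⟨k, hk, hkc⟩ := hK.exists_add_mul_pos (hcont (A * A + B * B)).neg
    ((hcont B).add ((hcont A).abs.const_mul c)) (fun v hv ↦ (hc v hv).le)
    (fun v hv h0 ↦ absurd h0 (hc v hv).ne')
  simp only [Pi.neg_apply, Pi.add_apply] at hkc
  -- The form of A² + B² is |Av|² + |Bv|², zero exactly on the common kernel. Subtracting it leaves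
  -- room to control the kernel of kB + tA.
  let Q := k • B - (A * A + B * B)
  have hQs : Q.IsSymm := by
    simp only [Q, IsSymm, transpose_sub, transpose_add, transpose_smul, transpose_mul, hA.eq,
      hB.eq]
  have hQe (v : Fin n → ℝ) : v ⬝ᵥ Q *ᵥ v = k * (v ⬝ᵥ B *ᵥ v) - v ⬝ᵥ (A * A + B * B) *ᵥ v := by
    simp only [Q, sub_mulVec, smul_mulVec, dotProduct_sub, dotProduct_smul, smul_eq_mul]
  have hsymm {X : Matrix (Fin n) (Fin n) ℝ} (hX : X.IsSymm) (v w : Fin n → ℝ) :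
      v ⬝ᵥ X *ᵥ w = w ⬝ᵥ X *ᵥ v := by
    rw [dotProduct_mulVec, ← mulVec_transpose, hX, dotProduct_comm]
  -- Both forms ignore the component in the common kernel and are homogeneous, so the bound on the
  -- sphere of W suffices.
  have hbound (v : Fin n → ℝ) : 0 ≤ v ⬝ᵥ Q *ᵥ v + k * c * |v ⬝ᵥ A *ᵥ v| := by
    obtain ⟨u, hu, w, hw, rfl⟩ := Submodule.mem_sup.1
      (hW.sup_eq_top ▸ Submodule.mem_top : v ∈ (nullSpace A ⊓ nullSpace B) ⊔ W)
    have hAu : A *ᵥ u = 0 := hu.1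
    have hBu : B *ᵥ u = 0 := hu.2
    have hQu : Q *ᵥ u = 0 := by
      simp only [Q, sub_mulVec, add_mulVec, smul_mulVec, ← mulVec_mulVec, hAu, hBu, mulVec_zero,
        smul_zero, add_zero, sub_zero]
    have hred {X : Matrix (Fin n) (Fin n) ℝ} (hX : X.IsSymm) (hXu : X *ᵥ u = 0) :
        (u + w) ⬝ᵥ X *ᵥ (u + w) = w ⬝ᵥ X *ᵥ w := by
      rw [mulVec_add, hXu, zero_add, add_dotProduct, hsymm hX u w, hXu, dotProduct_zero, zero_add]
    rw [hred hQs hQu, hred hA hAu]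
    rcases eq_or_ne w 0 with rfl | hw0
    · simp
    have hn : 0 < ‖w‖ := norm_pos_iff.2 hw0
    have hwK : ‖w‖⁻¹ • w ∈ Metric.sphere (0 : Fin n → ℝ) 1 ∩ W :=
      ⟨by simp [norm_smul, hn.ne'], W.smul_mem _ hw⟩
    have hscale (X : Matrix (Fin n) (Fin n) ℝ) :
        (‖w‖⁻¹ • w) ⬝ᵥ X *ᵥ (‖w‖⁻¹ • w) = (‖w‖⁻¹) ^ 2 * (w ⬝ᵥ X *ᵥ w) := by
      simp only [mulVec_smul, dotProduct_smul, smul_dotProduct, smul_eq_mul]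
      ring
    have := hkc _ hwK
    rw [hscale, hscale, hscale, abs_mul, abs_of_nonneg (sq_nonneg _)] at this
    refine (pos_of_mul_pos_right (a := (‖w‖⁻¹) ^ 2) ?_ (sq_nonneg _)).le
    rw [hQe]
    linarith
  obtain ⟨t, ht⟩ := exists_add_mul_nonneg (P := toBilin' A) (Q := toBilin' Q) (c := k * c)
    (fun v w ↦ by simpa only [toBilin'_apply'] using hsymm hA v w)
    (fun v w ↦ by simpa only [toBilin'_apply'] using hsymm hQs v w)
    (fun v ↦ by simpa only [toBilin'_apply'] using hbound v)
  simp only [toBilin'_apply', hQe] at ht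
  have hMe (v : Fin n → ℝ) :
      v ⬝ᵥ (k • B + t • A) *ᵥ v = k * (v ⬝ᵥ B *ᵥ v) + t * (v ⬝ᵥ A *ᵥ v) := by
    simp only [add_mulVec, smul_mulVec, dotProduct_add, dotProduct_smul, smul_eq_mul]
  have hGe (v : Fin n → ℝ) :
      v ⬝ᵥ (A * A + B * B) *ᵥ v = (A *ᵥ v) ⬝ᵥ (A *ᵥ v) + (B *ᵥ v) ⬝ᵥ (B *ᵥ v) := by
    rw [add_mulVec, dotProduct_add, ← mulVec_mulVec, ← mulVec_mulVec, hsymm hA, hsymm hB]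
  have hnn (w : Fin n → ℝ) : 0 ≤ w ⬝ᵥ w := Finset.sum_nonneg fun i _ ↦ mul_self_nonneg _
  have hMs : (k • B + t • A).IsSymm := (hB.smul k).add (hA.smul t)
  have hM : (k • B + t • A).PosSemidef := by
    refine .of_dotProduct_mulVec_nonneg ?_ fun v ↦ ?_
    · rw [IsHermitian, conjTranspose_eq_transpose_of_trivial, hMs]
    · rw [star_trivial, hMe]
      linarith [ht v, hGe v, hnn (A *ᵥ v), hnn (B *ᵥ v)]
  have hker (v : Fin n → ℝ) (hv : (k • B + t • A) *ᵥ v = 0) : A *ᵥ v = 0 := by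
    have h1 := hMe v
    rw [hv, dotProduct_zero] at h1
    exact dotProduct_self_eq_zero.1
      (by linarith [ht v, hGe v, hnn (A *ᵥ v), hnn (B *ᵥ v)])
  have := (of_posSemidef hM hA hker).combine 0 1 k⁻¹ (-(k⁻¹ * t))
  convert this using 1
  · module
  · rw [smul_add, smul_smul, smul_smul, inv_mul_cancel₀ hk.ne']
    module

end MatrixPencil

/-! ### The codimension-two exception and the conclusion -/

theorem finrank_add_two_eq_of_sup_span_pair_eq_top {n : ℕ} {N : Submodule ℝ (Fin n → ℝ)} {x y : Fin n → ℝ}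
    (hxy : ∀ a b : ℝ, a • x + b • y ∈ N → a = 0 ∧ b = 0)
    (h : N ⊔ Submodule.span ℝ {x, y} = ⊤) : Module.finrank ℝ N + 2 = n := by
  have hli : LinearIndependent ℝ ![x, y] :=
    LinearIndependent.pair_iff.2 fun a b hab ↦ hxy a b (hab ▸ N.zero_mem)
  have hf : Module.finrank ℝ (Submodule.span ℝ {x, y}) = 2 := by
    have := finrank_span_eq_card hli
    rwa [Matrix.range_cons_cons_empty, Fintype.card_fin] at this
  have hinf : N ⊓ Submodule.span ℝ {x, y} = ⊥ := by
    rw [Submodule.eq_bot_iff]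
    rintro v ⟨hv, hv'⟩
    obtain ⟨a, b, rfl⟩ := Submodule.mem_span_pair.1 hv'
    obtain ⟨rfl, rfl⟩ := hxy a b hv
    simp
  have := Submodule.finrank_sup_add_finrank_inf_eq N (Submodule.span ℝ {x, y})
  rw [h, hinf, hf, finrank_top, finrank_bot, Module.finrank_fin_fun] at this
  omega

open Matrix MatrixPencil in
theorem mainTheorem6 (n : ℕ) (A B : Matrix (Fin n) (Fin n) ℝ)
    (hA : A.IsSymm) (hB : B.IsSymm)
    (h : (MatrixPencil.psdInterval A B).Nontrivial ∨
      (MatrixPencil.psdInterval B A).Nontrivial ∨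
      (MatrixPencil.quadZeros A ∩ MatrixPencil.quadZeros B =
          (MatrixPencil.nullSpace A : Set (Fin n → ℝ)) ∩ MatrixPencil.nullSpace B ∧
        (Module.finrank ℝ ↥(MatrixPencil.nullSpace A ⊓ MatrixPencil.nullSpace B) : ℤ)
          ≠ (n : ℤ) - 2)) :
    MatrixPencil.SimDiagCongruence A B := by
  rcases h with h | h | ⟨hQ, hdim⟩
  · exact .of_nontrivial_psdInterval hB h
  · exact (SimDiagCongruence.of_nontrivial_psdInterval hA h).symm
  set N := nullSpace A ⊓ nullSpace B with hNdef
  have hN (v : Fin n → ℝ) (h1 : v ⬝ᵥ A *ᵥ v = 0) (h2 : v ⬝ᵥ B *ᵥ v = 0) : v ∈ N := by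
    have : v ∈ quadZeros A ∩ quadZeros B := ⟨h1, h2⟩
    rw [hQ] at this
    exact this
  by_cases hpos : ∀ v, v ⬝ᵥ A *ᵥ v = 0 → v ∉ N → 0 < v ⬝ᵥ B *ᵥ v
  · exact .of_pos_on_zeros hA hB hpos
  by_cases hneg : ∀ v, v ⬝ᵥ A *ᵥ v = 0 → v ∉ N → v ⬝ᵥ B *ᵥ v < 0
  · have hnull : nullSpace (-B) = nullSpace B := by
      ext v; simp [nullSpace]
    have := (SimDiagCongruence.of_pos_on_zeros hA (B := -B) hB.neg (fun v h1 h2 ↦ by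
      rw [hnull] at h2
      rw [neg_mulVec, dotProduct_neg]
      linarith [hneg v h1 h2])).combine 1 0 0 (-1)
    convert this using 1 <;> module
  exfalso
  push Not at hpos hneg
  obtain ⟨y, hy, hyN, hBy⟩ := hpos
  obtain ⟨x, hx, hxN, hBx⟩ := hneg
  replace hBy : y ⬝ᵥ B *ᵥ y < 0 := hBy.lt_of_ne fun h ↦ hyN (hN y hy h)
  replace hBx : 0 < x ⬝ᵥ B *ᵥ x := hBx.lt_of_ne fun h ↦ hxN (hN x hx h.symm)
  have hsymm {X : Matrix (Fin n) (Fin n) ℝ} (hX : X.IsSymm) (v w : Fin n → ℝ) :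
      toBilin' X v w = toBilin' X w v := by
    rw [toBilin'_apply', toBilin'_apply', dotProduct_mulVec, ← mulVec_transpose, hX,
      dotProduct_comm]
  have hN0 : ∀ v ∈ N, ∀ w, toBilin' B v w = 0 := fun v hv w ↦ by
    have hv : B *ᵥ v = 0 := hv.2
    rw [hsymm hB, toBilin'_apply', hv, dotProduct_zero]
  simp only [← toBilin'_apply'] at hx hy hBx hBy hN
  have hfalse (z : Fin n → ℝ) (hz : ∀ a b : ℝ, z + a • x + b • y ∉ N) : False :=
    false_of_sign_change (hsymm hA) (hsymm hB) hN0 hN hx hy hBx hBy hz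
  have hxy (a b : ℝ) (hab : a • x + b • y ∈ N) : a = 0 ∧ b = 0 := by
    have h1 := hN0 _ hab x
    have h2 := hN0 _ hab y
    simp only [map_add, map_smul, LinearMap.add_apply, LinearMap.smul_apply, smul_eq_mul,
      hsymm hB y x] at h1 h2
    -- The two sides have opposite signs, so both vanish.
    have h3 : a ^ 2 * toBilin' B x x = b ^ 2 * toBilin' B y y := by
      linear_combination a * h1 - b * h2
    have ha : a ^ 2 * toBilin' B x x = 0 :=
      le_antisymm (h3 ▸ mul_nonpos_of_nonneg_of_nonpos (sq_nonneg b) hBy.le) (by positivity)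
    have hb := h3 ▸ ha
    exact ⟨by simpa [hBx.ne'] using ha, by simpa [hBy.ne] using hb⟩
  -- A vector outside N + span{x, y} would serve as z in `hfalse`.
  have := finrank_add_two_eq_of_sup_span_pair_eq_top hxy (by
    rw [eq_top_iff]
    intro z _
    by_contra hz
    refine hfalse z fun a b hab ↦ hz ?_
    refine Submodule.mem_sup.2 ⟨_, hab, (-a) • x + (-b) • y,
      Submodule.mem_span_pair.2 ⟨_, _, rfl⟩, by module⟩)
  omega
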